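/- Let $n\ge 2$ and let $G$ be a Lie group. Let $SO(n)$ act on the unit sphere $S^n\subset\mathbf R^{n+1}=\mathbf R^n\times\mathbf R$ by $A\cdot(y,s)=(Ay,s)$. An $(n,G)$-bundle $\xi$ is a smooth principal $G$-bundle $p\colon E\to S^n$ (with right action of $G$ on the manifold $E$; we write $\xi^\flat$ for this underlying bundle), together with a smooth left action of $SO(n)$ on $E$ that commutes with the action of $G$ and makes $p$ equivariant. Let $SO(n-1)\subset SO(n)$ be the subgroup fixing the last basis vector $e_n$ of $\mathbf R^n$. An isotropic lifting for $\xi$ is a smooth curve $\tilde c\colon[-1,1]\to E$ with $p(\tilde c(t))=c(t):=(0,\dots,0,\cos(\pi t/2),\sin(\pi t/2))$ for which there is a map $\gamma\colon SO(n-1)\to G$ with $B\cdot\tilde c(t)=\tilde c(t)\cdot\gamma(B)$ for all $t\in[-1,1]$ and all $B\in SO(n-1)$. The isotropy representations $\alpha,\beta\colon SO(n)\to G$ associated to its end points are determined by $A\cdot\tilde c(-1)=\tilde c(-1)\cdot\alpha(A)$ and $A\cdot\tilde c(1)=\tilde c(1)\cdot\beta(A)$. Let $\pi_{n-1}(G)$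 be the set of pointed homotopy classes of pointed continuous maps $(S^{n-1},e_n)\to(G,e)$, where $e$ is the neutral element of $G$, and let $\pi_{n-1}(G)/\pi_0(G)$ be its quotient by the action of $\pi_0(G)$ induced by conjugation. The clutching class $C(\xi^\flat)\in\pi_{n-1}(G)/\pi_0(G)$ is the class of $\partial(\mathrm{id}_{S^n})$, where $\partial\colon\pi_n(S^n)\to\pi_{n-1}(G)$ is the boundary operator of the homotopy exact sequence of $\xi^\flat$. Explicitly, let $q\colon(D^n,S^{n-1})\to(S^n,(0,-1))$ be the relative homeomorphism $q(v)=(\sin(\pi|v|)\,v/|v|,\cos(\pi|v|))$, $q(0)=(0,1)$. If $L\colon D^n\to E$ is a continuous lift of $q$, and if $L(x)=e_0\cdot h(x)$ for $x\in S^{n-1}$, where $e_0=L(e_n)$, then $C(\xi^\flat)=[h]$. Proposition C. Let $\xi$ be an $(n,G)$-bundle, let $\tilde c$ be an isotropic lifting for $\xi$, and let $\alpha,\beta\colon SO(n)\to G$ be the isotropy representations associated to its end points $\tilde c(-1)$ and $\tilde c(1)$. Then the map $A\mapsto\alpha(A)\beta(A)^{-1}$ induces a continuous map $\bar\psi(\alpha,\beta)\colon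 S^{n-1}\cong SO(n)/SO(n-1)\to G$ (where the identification is $A\mapsto Ae_n$) with $\bar\psi(\alpha,\beta)(e_n)=e$, and $[\bar\psi(\alpha,\beta)]=C(\xi^\flat)$ in $\pi_{n-1}(G)/\pi_0(G)$: lifts $L$ as above exist, and each of them gives the class $[\bar\psi(\alpha,\beta)]$. -/

import Mathlib

/-! Throughout, `n = m + 1`: the group is `SO(m+1)`, the base is the sphere `S^{m+1}` in `ℝ^{m+2}`,
and `S^m` is the sphere `S^{n-1}` on which `SO(n)` acts linearly. -/

open scoped Manifold ContDiff RightActions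

namespace EquivariantClutching

/-- Euclidean space `ℝ^k`. -/
abbrev Euc (k : ℕ) : Type := EuclideanSpace ℝ (Fin k)

/-- The unit sphere `S^k` in `ℝ^{k+1}`. -/
abbrev Sph (k : ℕ) : Type := Metric.sphere (0 : Euc (k + 1)) 1

/-- The closed unit disc `D^k` in `ℝ^k`. -/
abbrev Disc (k : ℕ) : Type := Metric.closedBall (0 : Euc k) 1

/-- The group `SO(k)`. -/
abbrev SO (k : ℕ) : Type := Matrix.specialOrthogonalGroup (Fin k) ℝ

/-- Shortcut instance, for the speed of the instance search. -/
instance soSMul {k : ℕ} {X : Type*} [h : MulAction (SO k) X] : SMul (SO k) X := h.toSMul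

/-- A point of `S^{k-1}`, seen in the closed disc `D^k`. -/
def Sph.toDisc {m : ℕ} (x : Sph m) : Disc (m + 1) :=
  ⟨x.1, Metric.sphere_subset_closedBall x.2⟩

/-- The point `(y, s)` of `ℝ^k × ℝ = ℝ^{k+1}`. -/
noncomputable def pt {k : ℕ} (y : Euc k) (s : ℝ) : Euc (k + 1) :=
  WithLp.toLp 2 (Fin.snoc y.ofLp s)

theorem norm_sq_pt {k : ℕ} (y : Euc k) (s : ℝ) : ‖pt y s‖ ^ 2 = ‖y‖ ^ 2 + s ^ 2 := by
  simp [pt, EuclideanSpace.norm_sq_eq, Fin.sum_univ_castSucc]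

/-- The last vector `(0, …, 0, 1)` of the standard basis of `ℝ^{m+1}`. -/
noncomputable def lastVec (m : ℕ) : Euc (m + 1) := EuclideanSpace.single (Fin.last m) 1

theorem norm_lastVec (m : ℕ) : ‖lastVec m‖ = 1 := by simp [lastVec]

/-- The linear action of a matrix on `ℝ^k`. -/
noncomputable def mulEuc {k : ℕ} (A : SO k) (y : Euc k) : Euc k :=
  WithLp.toLp 2 (A.1.mulVec y.ofLp)

theorem norm_mulEuc {k : ℕ} (A : SO k) (y : Euc k) : ‖mulEuc A y‖ = ‖y‖ := by
  have hA : A.1.transpose * A.1 = 1 := by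
    have := (Matrix.mem_orthogonalGroup_iff' (Fin k) ℝ).1
      (Matrix.mem_specialOrthogonalGroup_iff.1 A.2).1
    simpa [Matrix.star_eq_conjTranspose] using this
  have h : (A.1.mulVec y.ofLp) ⬝ᵥ (A.1.mulVec y.ofLp) = y.ofLp ⬝ᵥ y.ofLp := by
    rw [Matrix.dotProduct_mulVec, ← Matrix.mulVec_transpose, Matrix.mulVec_mulVec, hA,
      Matrix.one_mulVec]
  have h2 : ‖mulEuc A y‖ ^ 2 = ‖y‖ ^ 2 := by
    rw [EuclideanSpace.norm_sq_eq, EuclideanSpace.norm_sq_eq]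
    simpa [mulEuc, dotProduct, ← pow_two] using h
  exact (sq_eq_sq₀ (norm_nonneg _) (norm_nonneg _)).1 h2

/-- The action of `SO(n)` on `ℝ^{n+1}` (hence on `S^n`) fixing the last coordinate:
`A · (y, s) = (A y, s)`. -/
noncomputable def rot {m : ℕ} (A : SO (m + 1)) (v : Euc (m + 2)) : Euc (m + 2) :=
  pt (mulEuc A (WithLp.toLp 2 (Fin.init v.ofLp))) (v (Fin.last (m + 1)))

/-- The map `ε : SO(n) → SO(n)/SO(n-1) ≅ S^{n-1}`, sending a matrix to its last column. -/
noncomputable def lastColumn {m : ℕ} (A : SO (m + 1)) : Sph m :=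
  ⟨mulEuc A (lastVec m), by simp [norm_mulEuc, norm_lastVec]⟩

/-- The base point `(0, …, 0, 1)` of `S^m`, the last column of the identity matrix. -/
noncomputable def basePt (m : ℕ) : Sph m := ⟨lastVec m, by simp [norm_lastVec]⟩

/-- `SO(n-1)`, as the subgroup of the matrices of `SO(n)` that fix `(0, …, 0, 1)`. -/
noncomputable def subSO (m : ℕ) : Submonoid (SO (m + 1)) where
  carrier := {B | mulEuc B (lastVec m) = lastVec m}
  one_mem' := by simp [mulEuc]
  mul_mem' := by
    intro A B hA hB
    have h : mulEuc (A * B) (lastVec m) = mulEuc A (mulEuc B (lastVec m)) := by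
      simp [mulEuc, Matrix.mulVec_mulVec]
    simp only [Set.mem_ofPred_eq] at hA hB ⊢
    rw [h, hB, hA]

/-- The meridian arc `c(t) = (0, …, 0, cos (π t / 2), sin (π t / 2))`, `-1 ≤ t ≤ 1`. -/
noncomputable def meridian (m : ℕ) (t : ℝ) : Euc (m + 2) :=
  pt (Real.cos (Real.pi * t / 2) • lastVec m) (Real.sin (Real.pi * t / 2))

/-! ### Homotopy classes -/

/-- Continuous maps `S^m → G` sending the base point to the neutral element. -/
def PointedMap (m : ℕ) (G : Type*) [TopologicalSpace G] [Group G] : Type _ :=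
  {h : C(Sph m, G) // h (basePt m) = 1}

/-- Homotopy relative to the base point. -/
instance pointedSetoid (m : ℕ) (G : Type*) [TopologicalSpace G] [Group G] :
    Setoid (PointedMap m G) where
  r f g := ContinuousMap.HomotopicRel f.1 g.1 {basePt m}
  iseqv := ⟨fun f => .refl f.1, fun h => h.symm, fun h h' => h.trans h'⟩

/-- The set `π_m(G)`, based at the neutral element: pointed homotopy classes of pointed maps
`S^m → G`. -/
def PiSph (m : ℕ) (G : Type*) [TopologicalSpace G] [Group G] : Type _ :=
  Quotient (pointedSetoid m G)

section Conj

variable {m : ℕ} {G : Type*} [TopologicalSpace G] [Group G] [IsTopologicalGroup G]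

/-- The inner automorphism `x ↦ g x g⁻¹`, as a continuous map. -/
def conjMap (g : G) : C(G, G) := ⟨fun x => g * x * g⁻¹, by fun_prop⟩

/-- The pointed map `x ↦ g h(x) g⁻¹`. -/
def PointedMap.conj (g : G) (h : PointedMap m G) : PointedMap m G :=
  ⟨(conjMap g).comp h.1, by simp [conjMap, h.2]⟩

/-- The action of `G` on `π_m(G)` induced by conjugation. The identity component of `G` acts
trivially, so this is an action of `π_0(G)`. -/
instance conjAction : MulAction G (PiSph m G) where
  smul g := Quotient.map (PointedMap.conj g) (fun _ _ h => h.comp_continuousMap (conjMap g))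
  one_smul := by
    rintro ⟨h⟩
    refine congrArg (Quotient.mk _) (Subtype.ext (ContinuousMap.ext fun x => ?_))
    simp [PointedMap.conj, conjMap]
  mul_smul := by
    rintro g g' ⟨h⟩
    refine congrArg (Quotient.mk _) (Subtype.ext (ContinuousMap.ext fun x => ?_))
    simp [PointedMap.conj, conjMap, mul_assoc]

variable (m G) in
/-- The quotient `π_m(G)/π_0(G)` of `π_m(G)` by conjugation. -/
def PiModConj : Type _ := MulAction.orbitRel.Quotient G (PiSph m G)

/-- The class in `π_m(G)/π_0(G)` of a pointed map `S^m → G`. -/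
def PointedMap.cls (h : PointedMap m G) : PiModConj m G :=
  Quotient.mk (MulAction.orbitRel G (PiSph m G)) (Quotient.mk (pointedSetoid m G) h)

end Conj

/-! ### The boundary operator -/

/-- The standard relative homeomorphism `(D^n, S^{n-1}) → (S^n, south pole)`,
`v ↦ (sin (π|v|) v/|v|, cos (π|v|))`: the centre goes to the north pole, every radius runs down a
meridian, and the boundary goes to the south pole `(0, …, 0, -1)`. -/
noncomputable def collapse {m : ℕ} (v : Disc (m + 1)) : Sph (m + 1) :=
  ⟨pt ((Real.sin (Real.pi * ‖v.1‖) / ‖v.1‖) • v.1) (Real.cos (Real.pi * ‖v.1‖)), by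
    have h : ‖(Real.sin (Real.pi * ‖v.1‖) / ‖v.1‖) • v.1‖ ^ 2 = Real.sin (Real.pi * ‖v.1‖) ^ 2 := by
      by_cases hv : ‖v.1‖ = 0
      · simp [hv]
      · rw [norm_smul, Real.norm_eq_abs, mul_pow, sq_abs, div_pow, div_mul_cancel₀]
        exact pow_ne_zero 2 hv
    have h2 := norm_sq_pt ((Real.sin (Real.pi * ‖v.1‖) / ‖v.1‖) • v.1)
      (Real.cos (Real.pi * ‖v.1‖))
    rw [h, Real.sin_sq_add_cos_sq] at h2
    rw [mem_sphere_zero_iff_norm]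
    exact (sq_eq_sq₀ (norm_nonneg _) zero_le_one).1 (by rw [h2, one_pow])⟩

/-- `κ` is the value, up to conjugation, of the boundary operator `∂ : π_n(B) → π_{n-1}(G)` of the
principal `G`-bundle `p : E → B` at the element represented by `f : S^n → B` (based at the south
pole): some lift `L : D^n → E` of `f ∘ collapse` restricts on `S^{n-1}` to `x ↦ e₀ · h(x)`, where
`e₀` lies over the image of the south pole and `h : S^{n-1} → G` is a pointed map of class `κ`. -/
def IsBoundary {m : ℕ} {G E B : Type*} [TopologicalSpace G] [Group G] [IsTopologicalGroup G]
    [TopologicalSpace E] [TopologicalSpace B] [MulAction Gᵐᵒᵖ E]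
    (p : E → B) (f : C(Sph (m + 1), B)) (κ : PiModConj m G) : Prop :=
  ∃ (e₀ : E) (L : C(Disc (m + 1), E)) (h : PointedMap m G),
    (∀ v, p (L v) = f (collapse v)) ∧ (∀ x : Sph m, L x.toDisc = e₀ <• h.1 x) ∧ h.cls = κ

/-- `κ` is the clutching class `[∂(id)] ∈ π_{n-1}(G)/π_0(G)` of the principal `G`-bundle
`p : E → S^n`. -/
def IsClutchingClass {m : ℕ} {G E : Type*} [TopologicalSpace G] [Group G] [IsTopologicalGroup G]
    [TopologicalSpace E] [MulAction Gᵐᵒᵖ E] (p : E → Sph (m + 1)) (κ : PiModConj m G) : Prop :=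
  IsBoundary p (ContinuousMap.id (Sph (m + 1))) κ

/-! ### Equivariant principal bundles -/

section Bundle

variable {m : ℕ}
  {V : Type*} [NormedAddCommGroup V] [NormedSpace ℝ V]
  {G : Type*} [TopologicalSpace G] [ChartedSpace V G] [Group G]
  {W : Type*} [NormedAddCommGroup W] [NormedSpace ℝ W]
  {E : Type*} [TopologicalSpace E] [ChartedSpace W E]

variable (V G W) in
/-- `p : E → S^n` is a smooth principal `G`-bundle, for a right action of `G` on the manifold `E`.
(`V` and `W` are the model spaces of `G` and `E`.) -/
structure IsPrincipalBundle [MulAction Gᵐᵒᵖ E] (p : E → Sph (m + 1)) : Prop where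
  smooth_proj : ContMDiff 𝓘(ℝ, W) (𝓡 (m + 1)) ∞ p
  smooth_act : ContMDiff (𝓘(ℝ, W).prod 𝓘(ℝ, V)) 𝓘(ℝ, W) ∞ (fun q : E × G => q.1 <• q.2)
  free : ∀ (z : E) (g : G), z <• g = z → g = 1
  proj_act : ∀ (z : E) (g : G), p (z <• g) = p z
  locally_trivial : ∀ x : Sph (m + 1), ∃ (U : Set (Sph (m + 1)))
    (φ : OpenPartialHomeomorph E (Sph (m + 1) × G)),
      IsOpen U ∧ x ∈ U ∧ φ.source = p ⁻¹' U ∧ φ.target = U ×ˢ Set.univ ∧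
      (∀ z ∈ φ.source, (φ z).1 = p z) ∧
      (∀ z ∈ φ.source, ∀ g : G, (φ (z <• g)).2 = (φ z).2 * g) ∧
      ContMDiffOn 𝓘(ℝ, W) ((𝓡 (m + 1)).prod 𝓘(ℝ, V)) ∞ φ φ.source ∧
      ContMDiffOn ((𝓡 (m + 1)).prod 𝓘(ℝ, V)) 𝓘(ℝ, W) ∞ φ.symm φ.target

variable (m W E) in
/-- The left action of `SO(n)` on the manifold `E` is smooth. Here `SO(n)` is a closed submanifold
of the vector space of matrices, and a map on `SO(n) × E` is smooth if it is the restriction of a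
map that is smooth on this subset of the product of that space and `E`. -/
def IsSmoothSOAction [MulAction (SO (m + 1)) E] : Prop :=
  ∃ F : (Fin (m + 1) → Fin (m + 1) → ℝ) × E → E,
    ContMDiffOn (𝓘(ℝ, Fin (m + 1) → Fin (m + 1) → ℝ).prod 𝓘(ℝ, W)) 𝓘(ℝ, W) ∞ F
      (Set.range (fun (A : SO (m + 1)) i j => A.1 i j) ×ˢ Set.univ) ∧
    ∀ (A : SO (m + 1)) (z : E), F (fun i j => A.1 i j, z) = A • z

variable (V G W) in
/-- `p : E → S^n` is an `(n, G)`-bundle: a principal `G`-bundle with a smooth left action of `SO(n)`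
on `E` that commutes with the right action of `G`, such that `p` is equivariant. -/
structure IsEquivariantBundle [MulAction Gᵐᵒᵖ E] [MulAction (SO (m + 1)) E]
    (p : E → Sph (m + 1)) : Prop where
  principal : IsPrincipalBundle V G W p
  smooth_rot : IsSmoothSOAction m W E
  commute : ∀ (A : SO (m + 1)) (z : E) (g : G), A • (z <• g) = (A • z) <• g
  proj_rot : ∀ (A : SO (m + 1)) (z : E), (p (A • z) : Euc (m + 2)) = rot A (p z)

variable (G W) in
/-- `c` (restricted to `[-1, 1]`) is an isotropic lifting of the meridian arc: a smooth lifting such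
that `B · c(t) = c(t) · γ(B)` for all `B ∈ SO(n-1)`, where `γ(B) ∈ G` does not depend on `t`. -/
structure IsIsotropicLifting [MulAction Gᵐᵒᵖ E] [MulAction (SO (m + 1)) E]
    (p : E → Sph (m + 1)) (c : ℝ → E) : Prop where
  smooth : ContMDiffOn 𝓘(ℝ, ℝ) 𝓘(ℝ, W) ∞ c (Set.Icc (-1) 1)
  lift : ∀ t ∈ Set.Icc (-1 : ℝ) 1, (p (c t) : Euc (m + 2)) = meridian m t
  isotropic : ∃ γ : subSO m → G, ∀ (B : subSO m), ∀ t ∈ Set.Icc (-1 : ℝ) 1,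
    B.1 • c t = c t <• γ B

/-- `α : SO(n) → G` is the isotropy representation at the point `a`: `A · a = a · α(A)`. -/
def IsIsotropyRep [MulAction Gᵐᵒᵖ E] [MulAction (SO (m + 1)) E] (a : E) (α : SO (m + 1) → G) :
    Prop :=
  ∀ A : SO (m + 1), A • a = a <• α A

end Bundle

end EquivariantClutching

open EquivariantClutching

/-! The isotropic lifting, spread out by the action, gives an explicit lift of the collapse map in
polar coordinates: `L(r A e_n) = A · c(1 - 2r) · β(A)⁻¹`. The factor `β(A)⁻¹` makes it well defined.
At `r = 0` it cancels `A · c(1) = c(1) · β(A)`. When `A` is replaced by `A B` with `B ∈ SO(n-1)`, it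
cancels `γ(B) = β(B)`, which by isotropy is the same along the whole arc. On the boundary `r = 1`
the lift equals `c(-1) · α(A) β(A)⁻¹`, so its clutching map is the required one (`exists_lift`,
`exists_pointedMap`).

Any other lift differs from `L` by a continuous `g : D^n → G` (`exists_continuousMap_eq_op_smul`).
Its boundary map is therefore `k⁻¹ ψ g` with `k = g(e_n)`, and contracting the disc to `e_n` deforms
it to the conjugate `k⁻¹ ψ k` (`cls_eq_of_eq_mul`). -/

namespace EquivariantClutching

open Topology

/-! ### The action of `SO(n)` on the sphere, and polar coordinates on the disc -/

section SpecialOrthogonal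

theorem continuous_mulEuc {k : ℕ} : Continuous fun q : SO k × Euc k => mulEuc q.1 q.2 := by
  unfold mulEuc
  fun_prop

theorem mulEuc_mul {k : ℕ} (A B : SO k) (y : Euc k) :
    mulEuc (A * B) y = mulEuc A (mulEuc B y) := by
  simp [mulEuc, Matrix.mulVec_mulVec]

theorem mulEuc_one {k : ℕ} (y : Euc k) : mulEuc (1 : SO k) y = y := by
  simp [mulEuc]

theorem mulEuc_smul {k : ℕ} (A : SO k) (a : ℝ) (y : Euc k) :
    mulEuc A (a • y) = a • mulEuc A y := by
  simp [mulEuc, Matrix.mulVec_smul]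

theorem rot_pt {m : ℕ} (A : SO (m + 1)) (y : Euc (m + 1)) (s : ℝ) :
    rot A (pt y s) = pt (mulEuc A y) s := by
  simp [rot, pt]

/-- Compactness makes the continuous surjections from `SO(n)` onto the sphere and from `[0, 1] ×
SO(n)` onto the disc quotient maps, so that continuous maps descend along them. -/
instance compactSpace_SO (k : ℕ) : CompactSpace (SO k) := by
  refine isCompact_iff_compactSpace.1 ?_
  have hK : IsCompact (Set.univ.pi fun _ => Set.univ.pi fun _ => Set.Icc (-1) 1 :
      Set (Matrix (Fin k) (Fin k) ℝ)) :=
    isCompact_univ_pi fun _ => isCompact_univ_pi fun _ => isCompact_Icc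
  refine hK.of_isClosed_subset ?_ fun A hA => ?_
  · have h : ((Matrix.specialOrthogonalGroup (Fin k) ℝ : Submonoid _) :
        Set (Matrix (Fin k) (Fin k) ℝ)) = {A | A * A.transpose = 1 ∧ A.det = 1} := by
      ext A
      simp [Matrix.mem_specialOrthogonalGroup_iff, Matrix.mem_orthogonalGroup_iff]
    rw [h]
    exact (isClosed_eq (by fun_prop) continuous_const).inter
      (isClosed_eq (Continuous.matrix_det continuous_id) continuous_const)
  · intro i _ j _
    have h := entry_norm_bound_of_unitary (𝕜 := ℝ)
      (Matrix.mem_specialOrthogonalGroup_iff.1 hA).1 i j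
    exact abs_le.1 h

theorem continuous_lastColumn {m : ℕ} : Continuous (lastColumn (m := m)) :=
  (continuous_mulEuc.comp (continuous_id.prodMk continuous_const)).subtype_mk _

theorem lastColumn_one (m : ℕ) : lastColumn (1 : SO (m + 1)) = basePt m :=
  Subtype.ext (mulEuc_one _)

/-- `SO(n)` acts transitively on `S^{n-1}` for `n ≥ 2`. -/
theorem lastColumn_surjective {m : ℕ} (hm : 1 ≤ m) :
    Function.Surjective (lastColumn (m := m)) := by
  intro x
  have hx : ‖x.1‖ = 1 := mem_sphere_zero_iff_norm.1 x.2
  obtain ⟨b, hb⟩ := Orthonormal.exists_orthonormalBasis_extension_of_card_eq (𝕜 := ℝ)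
    (E := Euc (m + 1)) (ι := Fin (m + 1)) (by simp) (v := fun _ => x.1) (s := {Fin.last m})
    (by
      rw [orthonormal_iff_ite]
      rintro ⟨i, rfl⟩ ⟨j, rfl⟩
      simp [hx])
  have hlast : b (Fin.last m) = x.1 := hb _ rfl
  let M : Matrix (Fin (m + 1)) (Fin (m + 1)) ℝ := Matrix.of fun i j => b j i
  have hM : M.transpose * M = 1 := by
    ext i j
    have h := (orthonormal_iff_ite.1 b.orthonormal) j i
    simp only [PiLp.inner_apply] at h
    simp only [Matrix.mul_apply, Matrix.transpose_apply, Matrix.one_apply, M, Matrix.of_apply]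
    simpa [eq_comm] using h
  have hdet : M.det = 1 ∨ M.det = -1 := by
    have h := congrArg Matrix.det hM
    rw [Matrix.det_mul, Matrix.det_transpose, Matrix.det_one] at h
    exact mul_self_eq_one_iff.1 h
  have key : ∀ N : Matrix (Fin (m + 1)) (Fin (m + 1)) ℝ, N.transpose * N = 1 → N.det = 1 →
      (∀ i, N i (Fin.last m) = x.1 i) → ∃ A, lastColumn (m := m) A = x := by
    intro N h1 h2 h3
    refine ⟨⟨N, Matrix.mem_specialOrthogonalGroup_iff.2
      ⟨(Matrix.mem_orthogonalGroup_iff' _ _).2 h1, h2⟩⟩, Subtype.ext ?_⟩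
    ext i
    simpa [lastColumn, mulEuc, lastVec] using h3 i
  rcases hdet with hdet | hdet
  · exact key M hM hdet fun i => by simp [M, hlast]
  -- Changing the sign of the first column corrects the determinant; since `n ≥ 2`, the last column
  -- is not affected.
  · let d : Fin (m + 1) → ℝ := Function.update 1 0 (-1)
    have hd : ∀ i, d i * d i = 1 := by
      intro i
      by_cases hi : i = 0 <;> simp [d, hi]
    have h0 : Fin.last m ≠ 0 := by
      intro h
      have := congrArg Fin.val h
      simp at this
      omega
    refine key (M * Matrix.diagonal d) ?_ ?_ fun i => ?_
    · rw [Matrix.transpose_mul, Matrix.diagonal_transpose, Matrix.mul_assoc,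
        ← Matrix.mul_assoc M.transpose, hM, Matrix.one_mul, Matrix.diagonal_mul_diagonal]
      simp [hd]
    · rw [Matrix.det_mul, hdet, Matrix.det_diagonal, Finset.prod_update_of_mem (Finset.mem_univ _)]
      simp
    · simp [Matrix.mul_diagonal, d, h0, M, hlast]

theorem exists_eq_mul_of_lastColumn_eq {m : ℕ} {A A' : SO (m + 1)}
    (h : lastColumn A = lastColumn A') : ∃ B : subSO m, A' = A * B.1 := by
  refine ⟨⟨A⁻¹ * A', ?_⟩, (mul_inv_cancel_left A A').symm⟩
  change mulEuc (A⁻¹ * A') (lastVec m) = lastVec m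
  have h' : mulEuc A (lastVec m) = mulEuc A' (lastVec m) := congrArg Subtype.val h
  rw [mulEuc_mul, ← h', ← mulEuc_mul, inv_mul_cancel, mulEuc_one]

/-- Polar coordinates `(r, A) ↦ r A e_n` on the disc `D^n`. -/
noncomputable def polar (m : ℕ) : C(unitInterval × SO (m + 1), Disc (m + 1)) where
  toFun q := ⟨(q.1 : ℝ) • mulEuc q.2 (lastVec m), by
    rw [mem_closedBall_zero_iff, norm_smul, norm_mulEuc, norm_lastVec, mul_one, Real.norm_eq_abs,
      abs_of_nonneg q.1.2.1]
    exact q.1.2.2⟩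
  continuous_toFun := by
    have h : Continuous fun q : unitInterval × SO (m + 1) => mulEuc q.2 (lastVec m) :=
      continuous_mulEuc.comp (continuous_snd.prodMk continuous_const)
    fun_prop

theorem norm_polar {m : ℕ} (r : unitInterval) (A : SO (m + 1)) : ‖(polar m (r, A)).1‖ = r := by
  simp [polar, norm_smul, norm_mulEuc, norm_lastVec, abs_of_nonneg r.2.1]

theorem polar_one {m : ℕ} (A : SO (m + 1)) : polar m (1, A) = (lastColumn A).toDisc :=
  Subtype.ext (one_smul ℝ _)

theorem polar_surjective {m : ℕ} (hm : 1 ≤ m) : Function.Surjective (polar m) := by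
  intro v
  have hv : ‖v.1‖ ≤ 1 := mem_closedBall_zero_iff.1 v.2
  by_cases h0 : v.1 = 0
  · exact ⟨(0, 1), Subtype.ext (by simp [polar, h0])⟩
  · have h1 : ‖v.1‖ ≠ 0 := norm_ne_zero_iff.2 h0
    obtain ⟨A, hA⟩ := lastColumn_surjective hm
      ⟨‖v.1‖⁻¹ • v.1, by simp [norm_smul, h1]⟩
    have hA' : mulEuc A (lastVec m) = ‖v.1‖⁻¹ • v.1 := congrArg Subtype.val hA
    refine ⟨(⟨‖v.1‖, norm_nonneg _, hv⟩, A), Subtype.ext ?_⟩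
    change ‖v.1‖ • mulEuc A (lastVec m) = v.1
    rw [hA', smul_inv_smul₀ h1]

/-- These are the only identifications made by polar coordinates, hence the two compatibility checks
needed to descend a map to the disc. -/
theorem polar_eq_iff {m : ℕ} {r r' : unitInterval} {A A' : SO (m + 1)}
    (h : polar m (r, A) = polar m (r', A')) :
    r = r' ∧ (r = 0 ∨ lastColumn A = lastColumn A') := by
  have hr : r = r' := Subtype.ext (by rw [← norm_polar r A, h, norm_polar])
  refine ⟨hr, or_iff_not_imp_left.2 fun h0 => Subtype.ext ?_⟩
  subst hr
  exact smul_right_injective _ (fun h' => h0 (Subtype.ext h')) (congrArg Subtype.val h)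

theorem isQuotientMap_polar {m : ℕ} (hm : 1 ≤ m) : IsQuotientMap (polar m) :=
  .of_surjective_continuous (polar_surjective hm) (polar m).continuous

theorem isQuotientMap_lastColumn {m : ℕ} (hm : 1 ≤ m) : IsQuotientMap (lastColumn (m := m)) :=
  .of_surjective_continuous (lastColumn_surjective hm) continuous_lastColumn

/-- The radius `r` corresponds to the time `1 - 2r` on the meridian: the centre is the north pole `t
= 1`, the boundary the south pole `t = -1`. -/
theorem collapse_polar {m : ℕ} (r : unitInterval) (A : SO (m + 1)) :
    (collapse (polar m (r, A)) : Euc (m + 2)) = rot A (meridian m (1 - 2 * r)) := by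
  have h1 : Real.pi * (1 - 2 * r) / 2 = Real.pi / 2 - Real.pi * r := by ring
  rw [meridian, rot_pt, mulEuc_smul, h1, Real.cos_pi_div_two_sub, Real.sin_pi_div_two_sub]
  simp only [collapse, norm_polar]
  congr 1
  change (_ / (r : ℝ)) • (r : ℝ) • mulEuc A (lastVec m) = _
  rw [smul_smul]
  by_cases h0 : (r : ℝ) = 0
  · simp [h0]
  · rw [div_mul_cancel₀ _ h0]

end SpecialOrthogonal

theorem op_smul_one {G E : Type*} [Group G] [MulAction Gᵐᵒᵖ E] (z : E) : z <• (1 : G) = z := by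
  rw [MulOpposite.op_one, one_smul]

/-! ### Comparison of lifts in a principal bundle -/

section Bundle

variable {m : ℕ}
  {V : Type*} [NormedAddCommGroup V] [NormedSpace ℝ V]
  {G : Type*} [TopologicalSpace G] [ChartedSpace V G] [Group G]
  {W : Type*} [NormedAddCommGroup W] [NormedSpace ℝ W]
  {E : Type*} [TopologicalSpace E] [ChartedSpace W E]

theorem IsPrincipalBundle.eq_of_op_smul_eq [MulAction Gᵐᵒᵖ E] {p : E → Sph (m + 1)}
    (hp : IsPrincipalBundle V G W p) {z : E} {g h : G} (H : z <• g = z <• h) : g = h := by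
  have h1 : z <• (g * h⁻¹) = z := by
    rw [← op_smul_op_smul, H, op_smul_op_smul, mul_inv_cancel, op_smul_one]
  exact mul_inv_eq_one.1 (hp.free z _ h1)

/-- Two continuous maps into a principal bundle with the same projection differ by a continuous
map into the structure group. -/
theorem IsPrincipalBundle.exists_continuousMap_eq_op_smul [IsTopologicalGroup G]
    [MulAction Gᵐᵒᵖ E] {p : E → Sph (m + 1)} (hp : IsPrincipalBundle V G W p)
    {X : Type*} [TopologicalSpace X] {f f' : X → E} (hf : Continuous f) (hf' : Continuous f')
    (h : ∀ x, p (f x) = p (f' x)) : ∃ g : C(X, G), ∀ x, f' x = f x <• g x := by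
  -- In a local trivialization with fibre coordinate `φ`, the difference of two points of one fibre
  -- is `φ(z)⁻¹ φ(z')`, which is continuous in both.
  have key : ∀ x₀ : X, ∃ φ : E → G, ∃ S : Set E, f x₀ ∈ S ∧ f' x₀ ∈ S ∧ IsOpen S ∧
      ContinuousOn φ S ∧
      ∀ z ∈ S, ∀ z' ∈ S, p z = p z' → z' = z <• ((φ z)⁻¹ * φ z') := by
    intro x₀
    obtain ⟨U, φ, -, hx, hs, -, hfst, hsnd, -, -⟩ := hp.locally_trivial (p (f x₀))
    refine ⟨fun z => (φ z).2, φ.source, by rw [hs]; exact hx,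
      by rw [hs, Set.mem_preimage, ← h]; exact hx, φ.open_source,
      continuous_snd.comp_continuousOn φ.continuousOn, fun z hz z' hz' hzz => ?_⟩
    have hz2 : z <• ((φ z).2⁻¹ * (φ z').2) ∈ φ.source := by
      rw [hs, Set.mem_preimage, hp.proj_act, ← Set.mem_preimage, ← hs]
      exact hz
    refine φ.injOn hz' hz2 (Prod.ext ?_ ?_)
    · rw [hfst _ hz', hfst _ hz2, hp.proj_act, hzz]
    · rw [hsnd _ hz, mul_inv_cancel_left]
  have hex : ∀ x, ∃ g : G, f' x = f x <• g := fun x => by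
    obtain ⟨φ, S, h1, h2, -, -, h3⟩ := key x
    exact ⟨_, h3 _ h1 _ h2 (h x)⟩
  choose g hg using hex
  refine ⟨⟨g, continuous_iff_continuousAt.2 fun x₀ => ?_⟩, hg⟩
  obtain ⟨φ, S, h1, h2, hS, hφ, h3⟩ := key x₀
  have hc : ContinuousAt (fun x => (φ (f x))⁻¹ * φ (f' x)) x₀ :=
    ((hφ.continuousAt (hS.mem_nhds h1)).comp hf.continuousAt).inv.mul
      ((hφ.continuousAt (hS.mem_nhds h2)).comp hf'.continuousAt)
  refine hc.congr ?_
  filter_upwards [hf.continuousAt (hS.mem_nhds h1), hf'.continuousAt (hS.mem_nhds h2)]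
    with x hx hx'
  exact hp.eq_of_op_smul_eq ((h3 _ hx _ hx' (h x)).symm.trans (hg x))

theorem IsSmoothSOAction.continuous [MulAction (SO (m + 1)) E] (h : IsSmoothSOAction m W E) :
    Continuous fun q : SO (m + 1) × E => q.1 • q.2 := by
  obtain ⟨F, hF, hF'⟩ := h
  have hc : Continuous fun q : SO (m + 1) × E => F (fun i j => q.1.1 i j, q.2) :=
    hF.continuousOn.comp_continuous (by fun_prop) fun q => ⟨⟨q.1, rfl⟩, trivial⟩
  exact hc.congr fun q => hF' q.1 q.2

/-- The contraction `(s, x) ↦ (1 - s) x + s e_n` of the disc, restricted to its boundary. -/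
noncomputable def contractSph (m : ℕ) : C(unitInterval × Sph m, Disc (m + 1)) where
  toFun q := ⟨(1 - (q.1 : ℝ)) • q.2.1 + (q.1 : ℝ) • lastVec m,
    (convex_closedBall (0 : Euc (m + 1)) 1) q.2.toDisc.2 (basePt m).toDisc.2
      (sub_nonneg.2 q.1.2.2) q.1.2.1 (by ring)⟩
  continuous_toFun := by fun_prop

theorem contractSph_zero {m : ℕ} (x : Sph m) : contractSph m (0, x) = x.toDisc :=
  Subtype.ext (by simp [contractSph, Sph.toDisc])

theorem contractSph_one {m : ℕ} (x : Sph m) : contractSph m (1, x) = (basePt m).toDisc :=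
  Subtype.ext (by simp [contractSph, Sph.toDisc, basePt])

theorem contractSph_basePt {m : ℕ} (s : unitInterval) :
    contractSph m (s, basePt m) = (basePt m).toDisc :=
  Subtype.ext (by simp [contractSph, Sph.toDisc, basePt, ← add_smul])

/-- If `h(x) = k⁻¹ ψ(x) g(x)` where `g` extends over the disc and `g(e_n) = k`, then `h` and `ψ`
have the same class modulo conjugation. -/
theorem PointedMap.cls_eq_of_eq_mul [IsTopologicalGroup G] {h ψ : PointedMap m G}
    (g : C(Disc (m + 1), G))
    (H : ∀ x, h.1 x = (g (basePt m).toDisc)⁻¹ * ψ.1 x * g x.toDisc) : h.cls = ψ.cls := by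
  set k := g (basePt m).toDisc with hk
  -- Only the argument of `g` moves, along the segment to `e_n`. This segment is constant for `x =
  -- e_n`, so the homotopy is pointed.
  have hom : ContinuousMap.HomotopicRel h.1 (PointedMap.conj k⁻¹ ψ).1 {basePt m} :=
    ⟨{ toFun := fun q => k⁻¹ * ψ.1 q.2 * g (contractSph m q)
       continuous_toFun := by fun_prop
       map_zero_left := fun x => by rw [H, contractSph_zero]
       map_one_left := fun x => by
        rw [contractSph_one, ← hk]
        simp [PointedMap.conj, conjMap]
       prop' := by
        rintro s x rfl
        change k⁻¹ * ψ.1 (basePt m) * g (contractSph m (s, basePt m)) = h.1 (basePt m)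
        rw [contractSph_basePt, h.2, ψ.2, ← hk]
        simp }⟩
  refine Quotient.sound (s := MulAction.orbitRel G (PiSph m G)) ⟨k⁻¹, ?_⟩
  exact (Quotient.sound (s := pointedSetoid m G) hom).symm

/-- The clutching class is independent of the lift. -/
theorem IsPrincipalBundle.cls_eq_of_lifts [IsTopologicalGroup G]
    [MulAction Gᵐᵒᵖ E] {p : E → Sph (m + 1)} (hp : IsPrincipalBundle V G W p)
    {L L' : C(Disc (m + 1), E)} (hL : ∀ v, p (L v) = p (L' v))
    {e e' : E} {ψ h : PointedMap m G} (hψ : ∀ x : Sph m, L x.toDisc = e <• ψ.1 x)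
    (hh : ∀ x : Sph m, L' x.toDisc = e' <• h.1 x) : h.cls = ψ.cls := by
  obtain ⟨g, hg⟩ := hp.exists_continuousMap_eq_op_smul L.continuous L'.continuous hL
  -- Both pointed maps are trivial at `e_n`, so the base points of the two lifts differ by `g(e_n)`.
  have he : e' = e <• g (basePt m).toDisc := by
    have h1 := hg (basePt m).toDisc
    rwa [hh, hψ, h.2, ψ.2, op_smul_one, op_smul_one] at h1
  refine PointedMap.cls_eq_of_eq_mul g fun x => ?_
  have h1 := hg x.toDisc
  rw [hh, hψ, he, op_smul_op_smul, op_smul_op_smul] at h1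
  rw [mul_assoc, ← hp.eq_of_op_smul_eq h1, inv_mul_cancel_left]

/-! ### Isotropy representations and the equivariant lift -/

section Equivariant

variable [MulAction Gᵐᵒᵖ E] [MulAction (SO (m + 1)) E] {p : E → Sph (m + 1)}

theorem IsEquivariantBundle.isotropyRep_mul (hp : IsEquivariantBundle V G W p) {a : E}
    {α : SO (m + 1) → G} (hα : IsIsotropyRep a α) (A B : SO (m + 1)) : α (A * B) = α A * α B := by
  refine hp.principal.eq_of_op_smul_eq (z := a) ?_
  rw [← hα, mul_smul, hα B, hp.commute, hα A, op_smul_op_smul]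

/-- The orbit map `A ↦ A · a` stays in the fibre of `a`; `α` is its difference from the constant map
`a`. -/
theorem IsEquivariantBundle.continuous_isotropyRep [IsTopologicalGroup G]
    (hp : IsEquivariantBundle V G W p) {a : E}
    {α : SO (m + 1) → G} (hα : IsIsotropyRep a α) : Continuous α := by
  obtain ⟨g, hg⟩ := hp.principal.exists_continuousMap_eq_op_smul (X := SO (m + 1))
    (f := fun _ => a) (f' := fun A => A • a) continuous_const
    (hp.smooth_rot.continuous.comp (continuous_id.prodMk continuous_const))
    fun A => by rw [hα, hp.principal.proj_act]
  have h : α = g := funext fun A =>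
    hp.principal.eq_of_op_smul_eq ((hα A).symm.trans (hg A))
  rw [h]
  exact g.continuous

/-- The map `S^{n-1} → G` induced by `A ↦ α(A) β(A)⁻¹`. -/
theorem IsEquivariantBundle.exists_pointedMap [IsTopologicalGroup G] (hm : 1 ≤ m)
    (hp : IsEquivariantBundle V G W p) {c : ℝ → E} (hc : IsIsotropicLifting G W p c)
    {α β : SO (m + 1) → G} (hα : IsIsotropyRep (c (-1)) α) (hβ : IsIsotropyRep (c 1) β) :
    ∃ ψ : PointedMap m G, ∀ A : SO (m + 1), ψ.1 (lastColumn A) = α A * (β A)⁻¹ := by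
  obtain ⟨γ, hγ⟩ := hc.isotropic
  have hcont : Continuous fun A => α A * (β A)⁻¹ :=
    (hp.continuous_isotropyRep hα).mul (hp.continuous_isotropyRep hβ).inv
  have hfac : ∀ A A' : SO (m + 1), lastColumn A = lastColumn A' →
      α A * (β A)⁻¹ = α A' * (β A')⁻¹ := by
    intro A A' h
    obtain ⟨B, rfl⟩ := exists_eq_mul_of_lastColumn_eq h
    -- Isotropy at the two end points shows that `α` and `β` agree on `SO(n-1)`, so `γ(B)` cancels
    -- in `α(A B) β(A B)⁻¹`.
    have h1 : α B.1 = γ B := hp.principal.eq_of_op_smul_eq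
      ((hα B.1).symm.trans (hγ B (-1) (by simp)))
    have h2 : β B.1 = γ B := hp.principal.eq_of_op_smul_eq
      ((hβ B.1).symm.trans (hγ B 1 (by simp)))
    rw [hp.isotropyRep_mul hα, hp.isotropyRep_mul hβ, h1, h2]
    group
  have hq : IsQuotientMap (⟨lastColumn, continuous_lastColumn⟩ : C(SO (m + 1), Sph m)) :=
    isQuotientMap_lastColumn hm
  let ψ : C(Sph m, G) := hq.lift ⟨_, hcont⟩ hfac
  have hψ : ∀ A : SO (m + 1), ψ (lastColumn A) = α A * (β A)⁻¹ := fun A =>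
    DFunLike.congr_fun (hq.lift_comp ⟨_, hcont⟩ hfac) A
  have hone : ∀ {a : E} {δ : SO (m + 1) → G}, IsIsotropyRep a δ → δ 1 = 1 := fun hδ => by
    have h := hp.isotropyRep_mul hδ 1 1
    rwa [mul_one, left_eq_mul] at h
  refine ⟨⟨ψ, ?_⟩, hψ⟩
  rw [← lastColumn_one, hψ, hone hα, hone hβ, inv_one, mul_one]

/-- The lift `r A e_n ↦ A · c(1 - 2r) · β(A)⁻¹` of the collapse map. -/
theorem IsEquivariantBundle.exists_lift [IsTopologicalGroup G] (hm : 1 ≤ m)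
    (hp : IsEquivariantBundle V G W p) {c : ℝ → E} (hc : IsIsotropicLifting G W p c)
    {β : SO (m + 1) → G} (hβ : IsIsotropyRep (c 1) β) :
    ∃ L : C(Disc (m + 1), E), (∀ v, p (L v) = collapse v) ∧
      ∀ A : SO (m + 1), L (lastColumn A).toDisc = (A • c (-1)) <• (β A)⁻¹ := by
  obtain ⟨γ, hγ⟩ := hc.isotropic
  have hmem : ∀ r : unitInterval, (1 - 2 * r : ℝ) ∈ Set.Icc (-1 : ℝ) 1 := fun r =>
    ⟨by linarith [r.2.2], by linarith [r.2.1]⟩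
  have hβc := hp.continuous_isotropyRep hβ
  have hcc : Continuous fun r : unitInterval => c (1 - 2 * r) :=
    hc.smooth.continuousOn.comp_continuous (by fun_prop) hmem
  let Φ : C(unitInterval × SO (m + 1), E) :=
    ⟨fun q => (q.2 • c (1 - 2 * q.1)) <• (β q.2)⁻¹,
      hp.principal.smooth_act.continuous.comp
        ((hp.smooth_rot.continuous.comp
          (continuous_snd.prodMk (hcc.comp continuous_fst))).prodMk
          (hβc.comp continuous_snd).inv)⟩
  have hfac : ∀ q q', polar m q = polar m q' → Φ q = Φ q' := by
    rintro ⟨r, A⟩ ⟨r', A'⟩ h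
    obtain ⟨rfl, h0 | h1⟩ := polar_eq_iff h
    -- At the centre, `A · c(1) · β(A)⁻¹ = c(1)` does not depend on `A`.
    · have hctr : ∀ A : SO (m + 1), Φ (r, A) = c 1 := fun A => by
        have h2 : (1 - 2 * r : ℝ) = 1 := by simp [h0]
        change (A • c (1 - 2 * r)) <• (β A)⁻¹ = c 1
        rw [h2, hβ, op_smul_op_smul, mul_inv_cancel, op_smul_one]
      rw [hctr, hctr]
    · obtain ⟨B, rfl⟩ := exists_eq_mul_of_lastColumn_eq h1
      have h2 : β B.1 = γ B := hp.principal.eq_of_op_smul_eq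
        ((hβ B.1).symm.trans (hγ B 1 (by simp)))
      change (A • c (1 - 2 * r)) <• (β A)⁻¹ = ((A * B.1) • c (1 - 2 * r)) <• (β (A * B.1))⁻¹
      rw [mul_smul, hγ B _ (hmem r), hp.commute, op_smul_op_smul, hp.isotropyRep_mul hβ, h2,
        mul_inv_rev, mul_inv_cancel_left]
  have hq := isQuotientMap_polar hm
  have hL : ∀ q, hq.lift Φ hfac (polar m q) = Φ q := fun q =>
    DFunLike.congr_fun (hq.lift_comp Φ hfac) q
  refine ⟨hq.lift Φ hfac, fun v => ?_, fun A => ?_⟩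
  · obtain ⟨⟨r, A⟩, rfl⟩ := polar_surjective hm v
    rw [hL]
    refine Subtype.ext ?_
    change (p ((A • c (1 - 2 * r)) <• (β A)⁻¹) : Euc (m + 2)) = _
    rw [hp.principal.proj_act, hp.proj_rot, hc.lift _ (hmem r), collapse_polar]
  · rw [← polar_one, hL]
    change (A • c (1 - 2 * ((1 : unitInterval) : ℝ))) <• (β A)⁻¹ = _
    norm_num

end Equivariant

end Bundle

end EquivariantClutching

theorem propositionC (m : ℕ) (hm : 1 ≤ m)
    {V : Type*} [NormedAddCommGroup V] [NormedSpace ℝ V] [FiniteDimensional ℝ V]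
    {G : Type*} [TopologicalSpace G] [ChartedSpace V G] [Group G] [LieGroup 𝓘(ℝ, V) ∞ G]
    [IsTopologicalGroup G]
    {W : Type*} [NormedAddCommGroup W] [NormedSpace ℝ W] [FiniteDimensional ℝ W]
    {E : Type*} [TopologicalSpace E] [ChartedSpace W E] [IsManifold 𝓘(ℝ, W) ∞ E]
    [MulAction Gᵐᵒᵖ E] [MulAction (SO (m + 1)) E]
    (p : E → Sph (m + 1)) (hp : IsEquivariantBundle V G W p)
    (c : ℝ → E) (hc : IsIsotropicLifting G W p c)
    (α β : SO (m + 1) → G)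
    (hα : IsIsotropyRep (c (-1)) α) (hβ : IsIsotropyRep (c 1) β) :
    ∃ ψ : PointedMap m G,
      (∀ A : SO (m + 1), ψ.1 (lastColumn A) = α A * (β A)⁻¹) ∧
      ∀ κ : PiModConj m G, IsClutchingClass p κ ↔ κ = ψ.cls := by
  obtain ⟨ψ, hψ⟩ := hp.exists_pointedMap hm hc hα hβ
  obtain ⟨L, hL, hL'⟩ := hp.exists_lift hm hc hβ
  have hbd : ∀ x : Sph m, L x.toDisc = c (-1) <• ψ.1 x := fun x => by
    obtain ⟨A, rfl⟩ := lastColumn_surjective hm x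
    rw [hL', hψ, hα, op_smul_op_smul]
  refine ⟨ψ, hψ, fun κ => ⟨?_, ?_⟩⟩
  · rintro ⟨e, L', h, h1, h2, rfl⟩
    exact hp.principal.cls_eq_of_lifts (fun v => (hL v).trans (h1 v).symm) hbd h2
  · rintro rfl
    exact ⟨c (-1), L, ψ, hL, hbd, rfl⟩
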